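/- **Setting.** Let $I$ be a finite set of $n\ge 2$ agents with finite nonempty action sets $A_i$. Every action profile $a$ comes with a random utility vector $U(a)=(U_i(a))_{i\in I}$, almost surely in $[0,1]^I$; put $M_i(a)=\mathbb E[U_i(a)]$. Let $\delta=1/K$ with $K\ge1$ an integer, and let the bins be $[0,\delta),[\delta,2\delta),\dots,[1-\delta,1),\{1\}$, ordered naturally. Let $v^-$ be the lower edge of a bin $v$, $|u|$ the bin of $u$, $v+k\delta$ the bin $v$ shifted by $k$ places, and write $v\approx w$ for $v\in\{w-\delta,w,w+\delta\}$. Let $\tau_0>0$, $c_F\in(0,1)$, and let $F$, $G$ be nonnegative functions on $[0,1]$ and $[0,1]^2$. Assume that the game is $3\delta$-interdependent: for every action profile $a$ and every $\emptyset\subsetneq J\subsetneq I$ there are $i\notin J$ and actions $a'_J$ with $|M_i(a'_J,a_{-J})-M_i(a)|\ge3\delta$. **The RITEL chain.** The state of an agent is either discontent, or a triple (mood, benchmark action $\bar a$, benchmark bin $\bar v$) with mood content, hopeful or watchful. A state of the chain gives the state of every agent; $D$ is the all-discontent state. For $\epsilon\in(0,1)$ let $\tau(\epsilon)=\lceil\tau_0\log(1/\epsilon)\rceil$.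 One step of the Markov chain $P^\epsilon$ is as follows. 1. The agents choose actions independently. A discontent agent plays a uniformly random action. A content agent with $\bar v<\{1\}$ plays, with probability $\epsilon$, a uniformly random action $a\neq\bar a$, and otherwise $\bar a$. Every other agent plays $\bar a$. 2. The resulting profile is played for $\tau(\epsilon)$ rounds with utility vectors sampled i.i.d. over the rounds. Each agent observes the bin $v$ of its average utility. 3. The agents update independently. A discontent agent that played $a$ becomes (content, $a$, $v$) with probability $\min(\epsilon^{F(v^-)},c_F)$, and otherwise stays discontent. A content agent that played $a\ne\bar a$ becomes (content, $a$, $v$) with probability $\epsilon^{G(\bar v^-,v^-)}$ if $v\ge\bar v+2\delta$, and otherwise keeps its state. An agent that is not discontent and played $\bar a$ returns to (content, $\bar a$, $\bar v$) if $v\approx\bar v$. If $v\ge\bar v+2\delta$, a content or watchful agent becomes hopeful (same benchmark) and a hopeful agent becomes (content, $\bar a$, $v$). If $v\le\bar v-2\delta$, a content or hopeful agent becomes watchful (same benchmark) and a watchful agent becomes discontent. **Optimal states with infinite noise resistance.** The resistance of a family $(X^\epsilon)_{\epsilon>0}$ of nonnegative reals is the $r\in[0,\infty]$ such that, as $\epsilon\to0$,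 $\epsilon^{-s}X^\epsilon\to0$ for all $s<r$ and $\epsilon^{-s}X^\epsilon\to\infty$ for all $s>r$. The noise resistance of an all-content state with benchmarks $(\bar a,\bar v)$ is the minimum, over all agents $i$ and all bins $v\not\approx\bar v_i$, of the resistance of the probability that agent $i$ observes $v$ when $\bar a$ is played for $\tau(\epsilon)$ rounds. The state is weakly aligned if, for every $i$, $|M_i(\bar a)|\approx\bar v_i$, and moreover $M_i(\bar a)\ne\bar v_i^--\delta$ if $U_i(\bar a)$ is not deterministic. Let $\mathcal A$ be the set of weakly aligned states in which every agent is content with benchmark bin $\{1\}$ and whose noise resistance is $+\infty$. **Possible states.** Let $\mathcal X_\epsilon$ be the set of states that $P^\epsilon$ can reach from $D$. A recurrence class is a nonempty set of mutually accessible states from which no state outside the set is accessible. **Proposition.** For every $\epsilon\in(0,1)$: * Every state in $\mathcal A$ is absorbing for $P^\epsilon$. If $\mathcal A\cap\mathcal X_\epsilon\neq\emptyset$, then the recurrence classes of $P^\epsilon$ are exactly the singletons $\{x\}$, $x\in\mathcal A$. Moreover, if an action profile $a$ satisfies $\mathbb P(U_i(a)=1\text{ for all }i)>0$, then the state in which all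 agents are content with benchmarks $(a_i,\{1\})$ belongs to $\mathcal X_\epsilon$. * If $\mathcal A\cap\mathcal X_\epsilon=\emptyset$ (in particular if $\mathcal A=\emptyset$), then $P^\epsilon$ restricted to $\mathcal X_\epsilon$ is irreducible and aperiodic, and the recurrence classes of $P^\epsilon$ on the whole state space are exactly $\mathcal X_\epsilon$ and the singletons $\{x\}$, $x\in\mathcal A$ (hence only $\mathcal X_\epsilon$ if $\mathcal A=\emptyset$). -/

import Mathlib

open MeasureTheory Filter Topology
open scoped ENNReal NNReal

noncomputable section

namespace RITEL

/-! ### Finite Markov chains, given by a transition matrix -/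

section MarkovChain

variable {S : Type*} [Fintype S] [DecidableEq S]

/-- `y` is accessible from `x`: some power of the transition matrix charges `(x, y)`. -/
def Accessible (P : Matrix S S ℝ) (x y : S) : Prop := ∃ k : ℕ, 0 < (P ^ k) x y

/-- Recurrence classes of a finite chain: the nonempty sets of mutually accessible states
from which no state outside the set is accessible. -/
def IsRecurrenceClass (P : Matrix S S ℝ) (C : Set S) : Prop :=
  C.Nonempty ∧ (∀ x ∈ C, ∀ y ∈ C, Accessible P x y) ∧
    ∀ x ∈ C, ∀ y, Accessible P x y → y ∈ C

/-- The chain stays in `x` forever once it is there. -/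
def IsAbsorbing (P : Matrix S S ℝ) (x : S) : Prop := P x x = 1

/-- The period of `x`, i.e. the greatest common divisor of the return times `k ≥ 1` with
`P ^ k` charging `(x, x)`, is one. -/
def IsAperiodicAt (P : Matrix S S ℝ) (x : S) : Prop :=
  ∀ d : ℕ, (∀ k : ℕ, 1 ≤ k → 0 < (P ^ k) x x → d ∣ k) → d = 1

end MarkovChain

/-! ### Almost regular families and their resistance -/

/-- The family `(X ε)`, `ε → 0+`, is almost regular with resistance `r ∈ [0, ∞]`. -/
def HasResistance (X : ℝ → ℝ) (r : ℝ≥0∞) : Prop :=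
  (∀ s : ℝ, (s : EReal) < (r : EReal) →
      Tendsto (fun ε : ℝ => ε ^ (-s) * X ε) (𝓝[>] 0) (𝓝 0)) ∧
    ∀ s : ℝ, (r : EReal) < (s : EReal) →
      Tendsto (fun ε : ℝ => ε ^ (-s) * X ε) (𝓝[>] 0) atTop

/-- The resistance of a family, as a total function: the supremum of the exponents `s ≥ 0`
with `ε ^ (-s) * X ε → 0`. By `HasResistance.resistance_eq` it is the resistance of every
almost regular family. -/
def resistance (X : ℝ → ℝ) : ℝ≥0∞ :=
  ⨆ (s : ℝ≥0) (_ : Tendsto (fun ε : ℝ => ε ^ (-(s : ℝ)) * X ε) (𝓝[>] 0) (𝓝 0)), (s : ℝ≥0∞)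

theorem HasResistance.resistance_eq {X : ℝ → ℝ} {r : ℝ≥0∞} (h : HasResistance X r) :
    resistance X = r := by
  apply le_antisymm
  · refine iSup₂_le fun s hs => ?_
    by_contra hlt
    have hlt' : (r : EReal) < ((s : ℝ≥0∞) : EReal) :=
      EReal.coe_ennreal_lt_coe_ennreal_iff.2 (not_le.1 hlt)
    exact not_tendsto_nhds_of_tendsto_atTop (h.2 (s : ℝ) hlt') 0 hs
  · refine le_of_forall_lt fun c hc => ?_
    obtain ⟨s, hcs, hsr⟩ := ENNReal.lt_iff_exists_nnreal_btwn.1 hc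
    have hsr' : ((s : ℝ≥0∞) : EReal) < (r : EReal) :=
      EReal.coe_ennreal_lt_coe_ennreal_iff.2 hsr
    exact lt_of_lt_of_le hcs (le_iSup₂_of_le s (h.1 (s : ℝ) hsr') le_rfl)

/-! ### Random games -/

/-- A random game with agents `ι` and action sets `A i`: every action profile comes with the
joint law of the agents' random utilities, which lie almost surely in `[0, 1]`. -/
structure RandomGame (ι : Type*) [Fintype ι] (A : ι → Type*) where
  law : (∀ i, A i) → Measure (ι → ℝ)
  isProbabilityMeasure_law : ∀ a, IsProbabilityMeasure (law a)
  mem_unitInterval : ∀ a, ∀ᵐ u ∂(law a), ∀ i, u i ∈ Set.Icc (0 : ℝ) 1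

/-- The parameters of the algorithm. The bin width is `δ = 1 / K`, the period length is
`⌈τ₀ * log (1 / ε)⌉`, the acceptance functions are `F` and `G`, and `cF` is the clipping
constant. -/
structure Params where
  K : ℕ
  K_pos : 0 < K
  τ₀ : ℝ
  τ₀_pos : 0 < τ₀
  F : ℝ → ℝ
  F_nonneg : ∀ u ∈ Set.Icc (0 : ℝ) 1, 0 ≤ F u
  G : ℝ → ℝ → ℝ
  G_nonneg : ∀ b ∈ Set.Icc (0 : ℝ) 1, ∀ u ∈ Set.Icc (0 : ℝ) 1, 0 ≤ G b u
  cF : ℝ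
  cF_pos : 0 < cF
  cF_lt_one : cF < 1

namespace Params

variable (p : Params)

/-- The bin width. -/
def δ : ℝ := 1 / p.K

/-- The bins: index `k < K` is `[k δ, (k + 1) δ)`, and the last index is `{1}`. -/
abbrev Bin : Type := Fin (p.K + 1)

/-- The top bin `{1}`. -/
def top : p.Bin := Fin.last p.K

/-- The bin of a utility `u ∈ [0, 1]`. -/
def bin (u : ℝ) : p.Bin := ⟨min ⌊u * p.K⌋₊ p.K, Nat.lt_succ_of_le (min_le_right _ _)⟩

/-- The lower edge of a bin. -/
def lower (v : p.Bin) : ℝ := (v : ℕ) * p.δ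

/-- The length of a period. -/
def period (ε : ℝ) : ℕ := ⌈p.τ₀ * Real.log (1 / ε)⌉₊

/-- `v ∈ {b - δ, b, b + δ}`: the observed bin `v` is not perceived as a change from `b`. -/
def Near (v b : p.Bin) : Prop := (v : ℕ) ≤ b + 1 ∧ (b : ℕ) ≤ v + 1

end Params

/-- The moods other than discontent. -/
inductive Mood
  | content
  | hopeful
  | watchful
  deriving DecidableEq

instance : Fintype Mood :=
  ⟨{Mood.content, Mood.hopeful, Mood.watchful}, fun m => by cases m <;> simp⟩

/-- The state of an agent: `none` is discontent (without benchmark), and `some (m, a, v)` is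
mood `m` with benchmark action `a` and benchmark bin `v`. -/
abbrev AgentState (p : Params) (B : Type*) : Type _ := Option (Mood × B × p.Bin)

/-- The states of the chain. -/
abbrev State (p : Params) {ι : Type*} (A : ι → Type*) : Type _ := ∀ i, AgentState p (A i)

/-- The all-discontent state `D`. -/
def allDiscontent (p : Params) {ι : Type*} (A : ι → Type*) : State p A := fun _ => none

/-! ### The policies -/

section Policies

/-- The probability vector that goes to `x` surely. -/
def surely {S : Type*} [DecidableEq S] (x : S) : S → ℝ := Pi.single x 1

/-- The probability vector that goes to `x` with probability `q`, else to `y`. -/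
def coin {S : Type*} [DecidableEq S] (q : ℝ) (x y : S) : S → ℝ :=
  fun z => q * surely x z + (1 - q) * surely y z

variable (p : Params) {B : Type*} [Fintype B] [DecidableEq B]

/-- The action policy: the probability of playing `a`. -/
def actionProb (ε : ℝ) : AgentState p B → B → ℝ
  | none, _ => 1 / (Fintype.card B : ℝ)
  | some (Mood.content, b, w), a =>
      if w = p.top then surely b a
      else if a = b then 1 - ε
      else ε / ((Fintype.card B : ℝ) - 1)
  | some (Mood.hopeful, b, _), a => surely b a
  | some (Mood.watchful, b, _), a => surely b a

/-- The update policy: the law of the new state of an agent that played `a` and observed the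
bin `v`. -/
def updateProb (ε : ℝ) : AgentState p B → B → p.Bin → AgentState p B → ℝ
  | none, a, v =>
      coin (min (ε ^ p.F (p.lower v)) p.cF) (some (Mood.content, a, v)) none
  | some (Mood.content, b, w), a, v =>
      if a ≠ b then
        if (w : ℕ) + 2 ≤ v then
          coin (ε ^ p.G (p.lower w) (p.lower v)) (some (Mood.content, a, v))
            (some (Mood.content, b, w))
        else surely (some (Mood.content, b, w))
      else
        if (w : ℕ) + 2 ≤ v then surely (some (Mood.hopeful, b, w))
        else if (v : ℕ) + 2 ≤ w then surely (some (Mood.watchful, b, w))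
        else surely (some (Mood.content, b, w))
  | some (Mood.hopeful, b, w), a, v =>
      if (w : ℕ) + 2 ≤ v then surely (some (Mood.content, a, v))
      else if (v : ℕ) + 2 ≤ w then surely (some (Mood.watchful, b, w))
      else surely (some (Mood.content, b, w))
  | some (Mood.watchful, b, w), _, v =>
      if (w : ℕ) + 2 ≤ v then surely (some (Mood.hopeful, b, w))
      else if (v : ℕ) + 2 ≤ w then surely none
      else surely (some (Mood.content, b, w))

end Policies

/-! ### The perturbed chain and its optimal states -/

namespace RandomGame

variable {ι : Type*} [Fintype ι] {A : ι → Type*} (g : RandomGame ι A) (p : Params)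

/-- The mean utility of agent `i` in the action profile `a`. -/
def mean (a : ∀ i, A i) (i : ι) : ℝ := ∫ u, u i ∂(g.law a)

/-- The utility of agent `i` in the action profile `a` is almost surely constant. -/
def IsDeterministic (a : ∀ i, A i) (i : ι) : Prop := ∃ c : ℝ, ∀ᵐ u ∂(g.law a), u i = c

/-- The law of `t` independent samples of the utility vector of the action profile `a`. -/
def samples (a : ∀ i, A i) (t : ℕ) : Measure (Fin t → ι → ℝ) :=
  Measure.pi fun _ => g.law a

/-- The empirical average of the samples of agent `i`. -/
def average {ι : Type*} {t : ℕ} (s : Fin t → ι → ℝ) (i : ι) : ℝ := (∑ k, s k i) / t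

/-- The probability that agent `i` observes the bin `v` after `t` plays of `a`. -/
def obsProb (a : ∀ i, A i) (i : ι) (t : ℕ) (v : p.Bin) : ℝ :=
  (g.samples a t).real {s | p.bin (average s i) = v}

/-- The probability that the agents observe the bins `v` after `t` plays of `a`. -/
def jointObsProb (a : ∀ i, A i) (t : ℕ) (v : ι → p.Bin) : ℝ :=
  (g.samples a t).real {s | ∀ i, p.bin (average s i) = v i}

/-- The transition matrix over a full period: actions are drawn from the action policies,
average utilities are sampled and binned, and states are updated by the update policies. -/
def transition [DecidableEq ι] [∀ i, Fintype (A i)] [∀ i, DecidableEq (A i)] (ε : ℝ) :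
    Matrix (State p A) (State p A) ℝ := fun x y =>
  ∑ a : ∀ i, A i, (∏ i, actionProb p ε (x i) (a i)) *
    ∑ v : ι → p.Bin, g.jointObsProb p a (p.period ε) v *
      ∏ i, updateProb p ε (x i) (a i) (v i) (y i)

/-- Interdependence with gap `ρ`: from any action profile, any nonempty proper set `J` of
agents can change the mean utility of some other agent by at least `ρ`. -/
def Interdependent (ρ : ℝ) : Prop :=
  ∀ (a : ∀ i, A i) (J : Set ι), J.Nonempty → J ≠ Set.univ →
    ∃ i ∉ J, ∃ a' : ∀ i, A i, (∀ j ∉ J, a' j = a j) ∧ ρ ≤ |g.mean a' i - g.mean a i|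

/-- Agent `i` with benchmark bin `w` is weakly aligned with the action profile `a`: its mean
utility lies in `w` or an adjacent bin, and is not the lower edge of `w - δ` unless the
utility is deterministic. -/
def WeaklyAligned (a : ∀ i, A i) (i : ι) (w : p.Bin) : Prop :=
  p.Near (p.bin (g.mean a i)) w ∧
    (¬ g.IsDeterministic a i → g.mean a i ≠ p.lower w - p.δ)

/-- The noise resistance of the benchmarks `(a, w)`: the minimum, over the agents `i` and the
bins `v ∉ {w i - δ, w i, w i + δ}`, of the resistance of observing `v` when `a` is played. -/
def noiseResistance (a : ∀ i, A i) (w : ι → p.Bin) : ℝ≥0∞ :=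
  ⨅ (i : ι) (v : p.Bin) (_ : ¬ p.Near v (w i)),
    resistance fun ε => g.obsProb p a i (p.period ε) v

/-- The optimal states with infinite noise resistance: all agents are content, weakly aligned
and have benchmark bin `{1}`, and the noise resistance of the state is infinite. -/
def optimalStates : Set (State p A) :=
  {x | ∃ (a : ∀ i, A i) (w : ι → p.Bin), (∀ i, x i = some (Mood.content, a i, w i)) ∧
    (∀ i, g.WeaklyAligned p a i (w i)) ∧ (∀ i, w i = p.top) ∧ g.noiseResistance p a w = ⊤}

/-- The states that the algorithm with perturbation `ε` can reach from the all-discontent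
state. -/
def possibleStates [DecidableEq ι] [∀ i, Fintype (A i)] [∀ i, DecidableEq (A i)] (ε : ℝ) :
    Set (State p A) :=
  {x | Accessible (g.transition p ε) (allDiscontent p A) x}

end RandomGame

end RITEL

end

namespace RITEL

/-! ### Accessibility, periods and recurrence classes of finite chains -/

section MarkovChain

variable {S : Type*} [Fintype S] [DecidableEq S] {P : Matrix S S ℝ}

/-! Two facts carry the proof. The first removes the asymptotics from `optimalStates`: by
`mem_optimalStates_iff`, infinite noise resistance at benchmark `{1}` means that every utility is
almost surely at least `1 - δ`. Indeed, a utility below `1 - δ` with probability `q > 0` stays below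
throughout a period with probability `q ^ τ(ε)`, which is only polynomially small because `τ(ε)` is
logarithmic. Conversely, averages of at least `1 - δ` fall in the two highest bins, so nobody
perceives a change and the state is absorbing for each fixed `ε`.

The second is `accessible_allDiscontent_or_optimal`: every state leads to `D` or to an optimal
state. Interdependence yields observations three bins apart, and any benchmark is at least two bins
away from one of them. The agent concerned can therefore be driven to discontent, if need be after
first raising its benchmark. Applied to the set of discontent agents, this spreads discontent to
everybody. Without discontent agents, one induces on the sum of the benchmark bins: either somebody
becomes discontent, or the sum rises, or all benchmarks are `{1}` and every possible observation is
compatible with them.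

Since recurrence classes are closed and disjoint, each is then an optimal singleton or the class of
`D`, if `D` is recurrent. The loop at `D` gives aperiodicity. -/

theorem pow_add_apply_pos (hP : ∀ x y, 0 ≤ P x y) {k l : ℕ} {x y z : S}
    (hxy : 0 < (P ^ k) x y) (hyz : 0 < (P ^ l) y z) : 0 < (P ^ (k + l)) x z := by
  rw [pow_add, Matrix.mul_apply]
  exact (mul_pos hxy hyz).trans_le <|
    Finset.single_le_sum (f := fun w => (P ^ k) x w * (P ^ l) w z)
      (fun w _ => mul_nonneg (Matrix.pow_apply_nonneg hP k x w) (Matrix.pow_apply_nonneg hP l w z))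
      (Finset.mem_univ y)

theorem Accessible.refl (P : Matrix S S ℝ) (x : S) : Accessible P x x := ⟨0, by simp⟩

theorem Accessible.single {x y : S} (h : 0 < P x y) : Accessible P x y := ⟨1, by simpa using h⟩

theorem Accessible.trans (hP : ∀ x y, 0 ≤ P x y) {x y z : S} (hxy : Accessible P x y)
    (hyz : Accessible P y z) : Accessible P x z := by
  obtain ⟨k, hk⟩ := hxy
  obtain ⟨l, hl⟩ := hyz
  exact ⟨k + l, pow_add_apply_pos hP hk hl⟩

theorem Accessible.reflTransGen (hP : ∀ x y, 0 ≤ P x y) {x y : S} (h : Accessible P x y) :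
    Relation.ReflTransGen (fun a b => 0 < P a b) x y := by
  obtain ⟨k, hk⟩ := h
  induction k generalizing y with
  | zero =>
    rcases eq_or_ne x y with rfl | hne
    · exact .refl
    · simp [Matrix.one_apply_ne hne] at hk
  | succ k ih =>
    rw [pow_succ, Matrix.mul_apply] at hk
    obtain ⟨z, -, hz⟩ := Finset.exists_lt_of_sum_lt
      (f := fun _ : S => (0 : ℝ)) (by simpa using hk)
    have h₁ := Matrix.pow_apply_nonneg hP k x z
    exact (ih (pos_of_mul_pos_left hz (hP z y))).tail (pos_of_mul_pos_right hz h₁)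

/-- A state from which only itself is reached in one step is the only state accessible from it. -/
theorem Accessible.eq_of_forall (hP : ∀ x y, 0 ≤ P x y) {x y : S}
    (hx : ∀ z, 0 < P x z → z = x) (h : Accessible P x y) : y = x := by
  have h' := h.reflTransGen hP
  clear h
  induction h' with
  | refl => rfl
  | tail _ hbc ih => exact hx _ (ih ▸ hbc)

/-- The states accessible from `d` form an irreducible chain if all of them lead back to `d` and
`d` has a loop. -/
theorem isIrreducible_accessible (hP : ∀ x y, 0 ≤ P x y) {d : S} (hd : 0 < P d d)
    (hback : ∀ x, Accessible P d x → Accessible P x d) :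
    Matrix.IsIrreducible (fun x y : {x | Accessible P d x} => P x y) := by
  refine ⟨fun x y => hP x y, ?_⟩
  let : Quiver {x | Accessible P d x} :=
    Matrix.toQuiver (fun x y : {x | Accessible P d x} => P x y)
  have key : ∀ (x : {x | Accessible P d x}) (y : S),
      Relation.ReflTransGen (fun a b => 0 < P a b) x y →
      ∃ hy : Accessible P d y, Nonempty (Quiver.Path x ⟨y, hy⟩) := by
    intro x y h
    induction h with
    | refl => exact ⟨x.2, ⟨Quiver.Path.nil⟩⟩
    | @tail b c _ hbc ih =>
      obtain ⟨hb, ⟨q⟩⟩ := ih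
      have hc : Accessible P d c := hb.trans hP (Accessible.single hbc)
      have e : (⟨b, hb⟩ : {x | Accessible P d x}) ⟶ ⟨c, hc⟩ := ⟨hbc⟩
      exact ⟨hc, ⟨q.cons e⟩⟩
  intro x y
  let d' : {x | Accessible P d x} := ⟨d, Accessible.refl P d⟩
  obtain ⟨_, ⟨q₁⟩⟩ := key x d ((hback x x.2).reflTransGen hP)
  obtain ⟨_, ⟨q₂⟩⟩ := key d' y (y.2.reflTransGen hP)
  have e : d' ⟶ d' := ⟨hd⟩
  exact ⟨(q₁.cons e).comp q₂, by simp⟩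

/-- Using the loop at `d` once or twice on a round trip gives return times that differ by one. -/
theorem isAperiodicAt_of_accessible_loop (hP : ∀ x y, 0 ≤ P x y) {d x : S} (hd : 0 < P d d)
    (hxd : Accessible P x d) (hdx : Accessible P d x) : IsAperiodicAt P x := by
  intro m hm
  obtain ⟨k, hk⟩ := hxd
  obtain ⟨l, hl⟩ := hdx
  have hd' : 0 < (P ^ 1) d d := by simpa using hd
  have h₁ := hm (k + 1 + l) (by omega)
    (pow_add_apply_pos hP (pow_add_apply_pos hP hk hd') hl)
  have h₂ := hm (k + 1 + 1 + l) (by omega)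
    (pow_add_apply_pos hP (pow_add_apply_pos hP (pow_add_apply_pos hP hk hd') hd') hl)
  have h₃ := Nat.dvd_sub h₂ h₁
  rw [show k + 1 + 1 + l - (k + 1 + l) = 1 by omega] at h₃
  exact Nat.dvd_one.1 h₃

theorem IsRecurrenceClass.eq_of_mem {C C' : Set S} (hC : IsRecurrenceClass P C)
    (hC' : IsRecurrenceClass P C') {x : S} (hx : x ∈ C) (hx' : x ∈ C') : C = C' :=
  Set.Subset.antisymm (fun y hy => hC'.2.2 x hx' y (hC.2.1 x hx y hy))
    fun y hy => hC.2.2 x hx y (hC'.2.1 x hx' y hy)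

theorem isRecurrenceClass_singleton {x : S} (h : ∀ y, Accessible P x y → y = x) :
    IsRecurrenceClass P {x} := by
  refine ⟨Set.singleton_nonempty x, ?_, ?_⟩
  · rintro _ rfl _ rfl
    exact Accessible.refl P _
  · rintro _ rfl y hy
    exact h y hy

theorem isRecurrenceClass_accessible (hP : ∀ x y, 0 ≤ P x y) {d : S}
    (hback : ∀ x, Accessible P d x → Accessible P x d) :
    IsRecurrenceClass P {x | Accessible P d x} :=
  ⟨⟨d, Accessible.refl P d⟩, fun x hx _ hy => (hback x hx).trans hP hy,
    fun _ hx _ hxy => Accessible.trans hP hx hxy⟩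

end MarkovChain

/-! ### Bins -/

namespace Params

variable (p : Params)

theorem K_cast_pos : (0 : ℝ) < p.K := Nat.cast_pos.2 p.K_pos

theorem δ_mul_K : p.δ * p.K = 1 := by
  have := p.K_cast_pos
  rw [δ, one_div, inv_mul_cancel₀ this.ne']

theorem δ_pos : 0 < p.δ := one_div_pos.2 p.K_cast_pos

theorem bin_mono : Monotone p.bin := fun u u' h => by
  have : ⌊u * p.K⌋₊ ≤ ⌊u' * p.K⌋₊ :=
    Nat.floor_le_floor (mul_le_mul_of_nonneg_right h p.K_cast_pos.le)
  exact Fin.mk_le_mk.2 (min_le_min_right _ this)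

/-- A shift by `3 * δ` is a shift by the integer 3 after scaling by `K`, so rounding loses nothing;
`y ≤ 1` keeps the cap at `K` from binding. -/
theorem bin_add_three_le {x y : ℝ} (hx : 0 ≤ x) (hy : y ≤ 1) (h : x + 3 * p.δ ≤ y) :
    (p.bin x : ℕ) + 3 ≤ p.bin y := by
  have hK := p.K_cast_pos
  have h₁ : x * p.K + (3 : ℕ) ≤ y * p.K := by
    have := mul_le_mul_of_nonneg_right h hK.le
    have h₂ := p.δ_mul_K
    push_cast
    linarith
  have h₂ := Nat.floor_le_floor h₁
  rw [Nat.floor_add_natCast (mul_nonneg hx hK.le)] at h₂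
  have h₃ : ⌊y * p.K⌋₊ ≤ p.K := Nat.floor_le_of_le (by nlinarith)
  change min _ _ + 3 ≤ min _ _
  omega

/-- With `le_bin_add_one`, this makes `1 - δ` the threshold between utilities that are near the top
bin and those perceived as a drop from it. -/
theorem bin_add_two_le (hK : 2 ≤ p.K) {u : ℝ} (hu : u < 1 - p.δ) : (p.bin u : ℕ) + 2 ≤ p.K := by
  have h₁ : u * p.K < (p.K - 1 : ℕ) := by
    have := mul_lt_mul_of_pos_right hu p.K_cast_pos
    have h₂ := p.δ_mul_K
    rw [Nat.cast_sub (by omega)]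
    push_cast
    linarith
  have h₂ : ⌊u * p.K⌋₊ < p.K - 1 := (Nat.floor_lt' (by omega)).2 h₁
  change min _ _ + 2 ≤ _
  omega

theorem le_bin_add_one {u : ℝ} (hu : 1 - p.δ ≤ u) : p.K ≤ (p.bin u : ℕ) + 1 := by
  have h₁ : ((p.K - 1 : ℕ) : ℝ) ≤ u * p.K := by
    have := mul_le_mul_of_nonneg_right hu p.K_cast_pos.le
    have h₂ := p.δ_mul_K
    have h₃ := p.K_pos
    rw [Nat.cast_sub (by omega)]
    push_cast
    linarith
  have h₂ := Nat.le_floor h₁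
  change _ ≤ min _ _ + 1
  omega

theorem bin_one : p.bin 1 = p.top := by
  apply Fin.ext
  change min _ _ = p.K
  simp

theorem lower_mem (v : p.Bin) : p.lower v ∈ Set.Icc (0 : ℝ) 1 := by
  have h₁ : ((v : ℕ) : ℝ) ≤ p.K := by exact_mod_cast Fin.is_le v
  have h₂ := p.δ_mul_K
  have h₃ := p.δ_pos
  exact ⟨mul_nonneg (Nat.cast_nonneg _) h₃.le, by unfold lower; nlinarith⟩

theorem lower_top : p.lower p.top = 1 := by
  have := p.δ_mul_K
  simp only [lower, top, Fin.val_last]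
  linarith

theorem measurable_bin : Measurable p.bin := by
  have h : Measurable fun u : ℝ => min ⌊u * p.K⌋₊ p.K :=
    (Nat.measurable_floor.comp (measurable_id.mul_const _)).min measurable_const
  refine measurable_to_countable' fun v => ?_
  have : p.bin ⁻¹' {v} = (fun u : ℝ => min ⌊u * p.K⌋₊ p.K) ⁻¹' {(v : ℕ)} := by
    ext u
    simp [bin, Fin.ext_iff]
  rw [this]
  exact h (measurableSet_singleton _)

theorem period_pos {ε : ℝ} (hε : 0 < ε) (hε' : ε < 1) : 0 < p.period ε :=
  Nat.ceil_pos.2 (mul_pos p.τ₀_pos (Real.log_pos (one_lt_one_div hε hε')))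

end Params

/-! ### Observations -/

namespace RandomGame

section Average

variable {ι : Type*}

theorem average_le {t : ℕ} (ht : 0 < t) {s : Fin t → ι → ℝ} {i : ι} {c : ℝ}
    (h : ∀ k, s k i ≤ c) : average s i ≤ c := by
  have h₁ : (0 : ℝ) < t := Nat.cast_pos.2 ht
  rw [average, div_le_iff₀ h₁]
  calc ∑ k, s k i ≤ ∑ _k : Fin t, c := Finset.sum_le_sum fun k _ => h k
    _ = c * t := by simp [mul_comm]

theorem le_average {t : ℕ} (ht : 0 < t) {s : Fin t → ι → ℝ} {i : ι} {c : ℝ}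
    (h : ∀ k, c ≤ s k i) : c ≤ average s i := by
  have h₁ : (0 : ℝ) < t := Nat.cast_pos.2 ht
  rw [average, le_div_iff₀ h₁]
  calc c * t = ∑ _k : Fin t, c := by simp [mul_comm]
    _ ≤ ∑ k, s k i := Finset.sum_le_sum fun k _ => h k

theorem average_lt {t : ℕ} (ht : 0 < t) {s : Fin t → ι → ℝ} {i : ι} {c : ℝ}
    (h : ∀ k, s k i < c) : average s i < c := by
  have h₁ : (0 : ℝ) < t := Nat.cast_pos.2 ht
  have : Nonempty (Fin t) := ⟨⟨0, ht⟩⟩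
  rw [average, div_lt_iff₀ h₁]
  calc ∑ k, s k i < ∑ _k : Fin t, c :=
        Finset.sum_lt_sum_of_nonempty Finset.univ_nonempty fun k _ => h k
    _ = c * t := by simp [mul_comm]

theorem measurable_average {t : ℕ} (i : ι) :
    Measurable fun s : Fin t → ι → ℝ => average s i := by
  unfold average
  fun_prop

end Average

variable {ι : Type*} [Fintype ι] {A : ι → Type*} (g : RandomGame ι A) (p : Params)

instance (a : ∀ i, A i) : IsProbabilityMeasure (g.law a) := g.isProbabilityMeasure_law a

instance (a : ∀ i, A i) (t : ℕ) : IsProbabilityMeasure (g.samples a t) := by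
  unfold samples
  infer_instance

theorem integrable_utility (a : ∀ i, A i) (i : ι) : Integrable (fun u => u i) (g.law a) :=
  Integrable.of_mem_Icc 0 1 (measurable_pi_apply i).aemeasurable
    ((g.mem_unitInterval a).mono fun _ h => h i)

theorem mean_nonneg (a : ∀ i, A i) (i : ι) : 0 ≤ g.mean a i :=
  integral_nonneg_of_ae ((g.mem_unitInterval a).mono fun _ h => (h i).1)

theorem mean_le_one (a : ∀ i, A i) (i : ι) : g.mean a i ≤ 1 := by
  have := integral_mono_ae (g.integrable_utility a i) (integrable_const (1 : ℝ))
    ((g.mem_unitInterval a).mono fun _ h => (h i).2)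
  rwa [integral_const, probReal_univ, one_smul] at this

theorem jointObsProb_nonneg (a : ∀ i, A i) (t : ℕ) (v : ι → p.Bin) :
    0 ≤ g.jointObsProb p a t v := measureReal_nonneg

theorem obsProb_nonneg (a : ∀ i, A i) (i : ι) (t : ℕ) (v : p.Bin) :
    0 ≤ g.obsProb p a i t v := measureReal_nonneg

theorem sum_jointObsProb [DecidableEq ι] (a : ∀ i, A i) (t : ℕ) :
    ∑ v, g.jointObsProb p a t v = 1 := by
  have hm : Measurable fun (s : Fin t → ι → ℝ) i => p.bin (average s i) :=
    measurable_pi_lambda _ fun i => p.measurable_bin.comp (measurable_average i)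
  have := sum_measureReal_preimage_singleton (μ := g.samples a t) (Finset.univ : Finset (ι → p.Bin))
    (f := fun (s : Fin t → ι → ℝ) i => p.bin (average s i))
    (fun v _ => hm (measurableSet_singleton v))
  simp only [Finset.coe_univ, Set.preimage_univ, probReal_univ] at this
  rw [← this]
  refine Finset.sum_congr rfl fun v _ => ?_
  unfold jointObsProb
  congr 1
  ext s
  simp [funext_iff]

/-- A set of samples of positive probability contains a sample whose bins are observed with
positive probability. -/
theorem exists_mem_jointObsProb_pos (a : ∀ i, A i) {t : ℕ} {E : Set (Fin t → ι → ℝ)}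
    (hE : g.samples a t E ≠ 0) :
    ∃ s ∈ E, 0 < g.jointObsProb p a t fun i => p.bin (average s i) := by
  by_contra! h
  -- Otherwise `E` is covered by finitely many null sets, one for each bin profile of probability
  -- zero.
  refine hE (measure_mono_null (t := ⋃ v : {v // g.jointObsProb p a t v ≤ 0},
    {s | ∀ i, p.bin (average s i) = v.1 i}) (fun s hs => ?_) (measure_iUnion_null fun v => ?_))
  · exact Set.mem_iUnion.2 ⟨⟨_, h s hs⟩, fun _ => rfl⟩
  · exact (measureReal_eq_zero_iff).1 (le_antisymm v.2 measureReal_nonneg)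

theorem samples_forall (a : ∀ i, A i) (t : ℕ) (E : Set (ι → ℝ)) :
    g.samples a t {s | ∀ k, s k ∈ E} = g.law a E ^ t := by
  have : {s : Fin t → ι → ℝ | ∀ k, s k ∈ E} = Set.univ.pi fun _ => E := by
    ext s
    simp
  rw [this, samples, Measure.pi_pi]
  simp

theorem exists_obs_of_law_pos (a : ∀ i, A i) (t : ℕ) {E : Set (ι → ℝ)} (hE : 0 < g.law a E) :
    ∃ s : Fin t → ι → ℝ, (∀ k, s k ∈ E) ∧
      0 < g.jointObsProb p a t fun i => p.bin (average s i) :=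
  g.exists_mem_jointObsProb_pos p a (E := {s | ∀ k, s k ∈ E})
    (by rw [samples_forall]; exact pow_ne_zero _ hE.ne')

theorem exists_obs (a : ∀ i, A i) (t : ℕ) : ∃ v, 0 < g.jointObsProb p a t v := by
  obtain ⟨s, -, h⟩ := g.exists_obs_of_law_pos p a t (E := Set.univ) (by simp)
  exact ⟨_, h⟩

/-- A random variable is at most its mean with positive probability, and this may happen in every
round of the period. -/
theorem exists_obs_le_mean (a : ∀ i, A i) {t : ℕ} (ht : 0 < t) (i : ι) :
    ∃ v, 0 < g.jointObsProb p a t v ∧ v i ≤ p.bin (g.mean a i) := by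
  obtain ⟨s, hs, h⟩ := g.exists_obs_of_law_pos p a t
    (measure_le_integral_pos (g.integrable_utility a i))
  exact ⟨_, h, p.bin_mono (average_le ht hs)⟩

theorem exists_obs_mean_le (a : ∀ i, A i) {t : ℕ} (ht : 0 < t) (i : ι) :
    ∃ v, 0 < g.jointObsProb p a t v ∧ p.bin (g.mean a i) ≤ v i := by
  obtain ⟨s, hs, h⟩ := g.exists_obs_of_law_pos p a t
    (measure_integral_le_pos (g.integrable_utility a i))
  exact ⟨_, h, p.bin_mono (le_average ht hs)⟩

theorem ae_samples {a : ∀ i, A i} {t : ℕ} {E : (ι → ℝ) → Prop} (h : ∀ᵐ u ∂g.law a, E u) :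
    ∀ᵐ s ∂g.samples a t, ∀ k, E (s k) :=
  eventually_all.2 fun _ => Measure.tendsto_eval_ae_ae.eventually h

theorem ae_le_bin_add_one {a : ∀ i, A i} {i : ι} (h : ∀ᵐ u ∂g.law a, 1 - p.δ ≤ u i) {t : ℕ}
    (ht : 0 < t) : ∀ᵐ s ∂g.samples a t, p.K ≤ (p.bin (average s i) : ℕ) + 1 :=
  (g.ae_samples h).mono fun _ hs => p.le_bin_add_one (le_average ht hs)

theorem le_of_jointObsProb_pos {a : ∀ i, A i} {i : ι} (h : ∀ᵐ u ∂g.law a, 1 - p.δ ≤ u i)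
    {t : ℕ} (ht : 0 < t) {v : ι → p.Bin} (hv : 0 < g.jointObsProb p a t v) :
    p.K ≤ (v i : ℕ) + 1 := by
  by_contra hlt
  refine hv.ne' ((measureReal_eq_zero_iff).2 (measure_mono_null (fun s hs => ?_)
    (ae_iff.1 (g.ae_le_bin_add_one p h ht))))
  simpa [hs i] using hlt

theorem obsProb_eq_zero {a : ∀ i, A i} {i : ι} (h : ∀ᵐ u ∂g.law a, 1 - p.δ ≤ u i)
    {t : ℕ} (ht : 0 < t) {v : p.Bin} (hv : ¬ p.K ≤ (v : ℕ) + 1) : g.obsProb p a i t v = 0 := by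
  refine (measureReal_eq_zero_iff).2 (measure_mono_null (fun s hs => ?_)
    (ae_iff.1 (g.ae_le_bin_add_one p h ht)))
  rw [Set.mem_ofPred_eq] at hs ⊢
  rwa [hs]

/-- If all observations possible after `t` plays are within one bin of the top, then utilities are
almost surely at least `1 - δ`. -/
theorem ae_le_of_forall_obs (hK : 2 ≤ p.K) {a : ∀ i, A i} {i : ι} {t : ℕ} (ht : 0 < t)
    (h : ∀ v, 0 < g.jointObsProb p a t v → p.K ≤ (v i : ℕ) + 1) :
    ∀ᵐ u ∂g.law a, 1 - p.δ ≤ u i := by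
  by_contra hne
  have hpos : 0 < g.law a {u | u i < 1 - p.δ} := by
    simp only [ae_iff, not_le] at hne
    exact pos_iff_ne_zero.2 hne
  obtain ⟨s, hs, hv⟩ := g.exists_obs_of_law_pos p a t hpos
  have h₁ := p.bin_add_two_le hK (average_lt ht hs)
  have h₂ := h _ hv
  omega

/-! ### Optimal states -/

theorem law_pow_le_sum_obsProb (hK : 2 ≤ p.K) (a : ∀ i, A i) (i : ι) {t : ℕ} (ht : 0 < t) :
    (g.law a).real {u | u i < 1 - p.δ} ^ t ≤
      ∑ v ∈ Finset.univ.filter (fun v : p.Bin => (v : ℕ) + 2 ≤ p.K), g.obsProb p a i t v := by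
  have h₁ : (g.law a).real {u | u i < 1 - p.δ} ^ t =
      (g.samples a t).real {s | ∀ k, s k ∈ {u : ι → ℝ | u i < 1 - p.δ}} := by
    rw [measureReal_def, measureReal_def, samples_forall, ENNReal.toReal_pow]
  rw [h₁]
  refine le_trans (measureReal_mono (fun s hs => ?_) (measure_ne_top _ _)) (measureReal_biUnion_finset_le _ _)
  simp only [Set.mem_iUnion]
  exact ⟨p.bin (average s i), by simpa using p.bin_add_two_le hK (average_lt ht hs), rfl⟩

/-- The supremum provides some admissible exponent above `s`, and for `ε < 1` smaller exponents give
smaller products. -/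
theorem tendsto_of_resistance_eq_top {X : ℝ → ℝ} (hX : ∀ ε, 0 ≤ X ε) (h : resistance X = ⊤)
    (s : ℝ) : Tendsto (fun ε : ℝ => ε ^ (-s) * X ε) (𝓝[>] 0) (𝓝 0) := by
  have h₁ : (Real.toNNReal s : ℝ≥0∞) < resistance X := h ▸ ENNReal.coe_lt_top
  unfold resistance at h₁
  obtain ⟨r, hr⟩ := lt_iSup_iff.1 h₁
  obtain ⟨hr, hsr⟩ := lt_iSup_iff.1 hr
  have hsr' : s ≤ r := (Real.toNNReal_le_iff_le_coe).1 (ENNReal.coe_lt_coe.1 hsr).le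
  have hmem : ∀ᶠ ε : ℝ in 𝓝[>] 0, ε ∈ Set.Ioo (0 : ℝ) 1 := Ioo_mem_nhdsGT one_pos
  refine squeeze_zero' (hmem.mono fun ε hε => ?_) (hmem.mono fun ε hε => ?_) hr
  · exact mul_nonneg (Real.rpow_nonneg hε.1.le _) (hX ε)
  · exact mul_le_mul_of_nonneg_right
      (Real.rpow_le_rpow_of_exponent_ge hε.1 hε.2.le (by linarith)) (hX ε)

theorem resistance_eq_top_of_eventually_eq_zero {X : ℝ → ℝ} (h : ∀ᶠ ε in 𝓝[>] (0 : ℝ), X ε = 0) :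
    resistance X = ⊤ := by
  refine ENNReal.eq_top_of_forall_nnreal_le fun r => ?_
  refine le_iSup₂_of_le r ?_ le_rfl
  exact tendsto_const_nhds.congr' (h.mono fun ε hε => by simp [hε])

theorem ae_le_of_noiseResistance_eq_top (hK : 2 ≤ p.K) {a : ∀ i, A i}
    (h : g.noiseResistance p a (fun _ => p.top) = ⊤) (i : ι) :
    ∀ᵐ u ∂g.law a, 1 - p.δ ≤ u i := by
  by_contra hne
  set q := (g.law a).real {u | u i < 1 - p.δ} with hq
  have hq0 : 0 < q := by
    simp only [ae_iff, not_le] at hne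
    exact ENNReal.toReal_pos hne (measure_ne_top _ _)
  have hq1 : q ≤ 1 := measureReal_le_one
  -- The decay exponent of `q ^ (τ₀ * log (1 / ε))`, which equals `ε ^ s`.
  set s := -(p.τ₀ * Real.log q) with hs
  have hlim : Tendsto (fun ε : ℝ => ∑ v ∈ Finset.univ.filter (fun v : p.Bin => (v : ℕ) + 2 ≤ p.K),
      ε ^ (-s) * g.obsProb p a i (p.period ε) v) (𝓝[>] 0) (𝓝 0) := by
    rw [show 𝓝 (0 : ℝ) = 𝓝 (∑ _v ∈ Finset.univ.filter (fun v : p.Bin => (v : ℕ) + 2 ≤ p.K), 0) by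
      rw [Finset.sum_const_zero]]
    refine tendsto_finsetSum _ fun v hv => ?_
    refine tendsto_of_resistance_eq_top (fun ε => g.obsProb_nonneg p a i _ v) ?_ s
    unfold noiseResistance at h
    simp only [iInf_eq_top] at h
    refine h i v fun hn => ?_
    have h₁ := (Finset.mem_filter.1 hv).2
    have h₂ := hn.2
    simp only [Params.top, Fin.val_last] at h₂
    omega
  have hmem : ∀ᶠ ε : ℝ in 𝓝[>] 0, ε ∈ Set.Ioo (0 : ℝ) 1 := Ioo_mem_nhdsGT one_pos
  refine absurd (ge_of_tendsto hlim (hmem.mono fun ε hε => ?_)) (not_le.2 hq0)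
  rw [← Finset.mul_sum]
  have hlog : 0 < Real.log (1 / ε) := Real.log_pos (one_lt_one_div hε.1 hε.2)
  have h₁ := g.law_pow_le_sum_obsProb p hK a i (p.period_pos hε.1 hε.2)
  -- The `+ 1` pays for the ceiling in the period and costs a constant factor `q`, which is the
  -- lower bound that contradicts the limit zero.
  have h₂ : q ^ (p.τ₀ * Real.log (1 / ε) + 1) ≤ q ^ p.period ε := by
    rw [← Real.rpow_natCast]
    exact Real.rpow_le_rpow_of_exponent_ge hq0 hq1
      (Nat.ceil_lt_add_one (mul_pos p.τ₀_pos hlog).le).le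
  have h₃ : ε ^ (-s) * q ^ (p.τ₀ * Real.log (1 / ε) + 1) = q := by
    rw [Real.rpow_add_one hq0.ne', Real.rpow_def_of_pos hε.1, Real.rpow_def_of_pos hq0,
      ← mul_assoc, ← Real.exp_add, hs, one_div, Real.log_inv]
    ring_nf
    simp
  calc q = ε ^ (-s) * q ^ (p.τ₀ * Real.log (1 / ε) + 1) := h₃.symm
    _ ≤ _ := mul_le_mul_of_nonneg_left (h₂.trans h₁) (Real.rpow_nonneg hε.1.le _)

/-- The excluded mean `1 - δ` is also the almost sure lower bound, so it is attained only by a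
deterministic utility. -/
theorem weaklyAligned_top {a : ∀ i, A i} {i : ι} (h : ∀ᵐ u ∂g.law a, 1 - p.δ ≤ u i) :
    g.WeaklyAligned p a i p.top := by
  have hint := g.integrable_utility a i
  have hmean : 1 - p.δ ≤ g.mean a i := by
    have := integral_mono_ae (integrable_const (1 - p.δ)) hint h
    rwa [integral_const, probReal_univ, one_smul] at this
  refine ⟨⟨?_, ?_⟩, fun hdet heq => hdet ⟨1 - p.δ, ?_⟩⟩
  · exact (Fin.is_le _).trans (Nat.le_succ _)
  · exact p.le_bin_add_one hmean
  · rw [p.lower_top] at heq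
    have hzero : ∫ u, (u i - (1 - p.δ)) ∂g.law a = 0 := by
      rw [integral_sub hint (integrable_const _)]
      change g.mean a i - _ = 0
      simp [heq]
    have := (integral_eq_zero_iff_of_nonneg_ae (h.mono fun u hu => sub_nonneg.2 hu)
      (hint.sub (integrable_const _))).1 hzero
    exact this.mono fun u hu => sub_eq_zero.1 hu

/-- The optimal states with infinite noise resistance are those in which all agents are content
with benchmark bin `{1}` and get almost surely a utility of at least `1 - δ`. -/
theorem mem_optimalStates_iff (hK : 2 ≤ p.K) {x : State p A} :
    x ∈ g.optimalStates p ↔ ∃ a : ∀ i, A i, (∀ i, x i = some (Mood.content, a i, p.top)) ∧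
      ∀ i, ∀ᵐ u ∂g.law a, 1 - p.δ ≤ u i := by
  constructor
  · rintro ⟨a, w, hx, -, hw, hr⟩
    obtain rfl : w = fun _ => p.top := funext hw
    exact ⟨a, hx, g.ae_le_of_noiseResistance_eq_top p hK hr⟩
  · rintro ⟨a, hx, h⟩
    refine ⟨a, fun _ => p.top, hx, fun i => g.weaklyAligned_top p (h i), fun _ => rfl, ?_⟩
    unfold noiseResistance
    simp only [iInf_eq_top]
    intro i v hv
    have hv' : ¬ p.K ≤ (v : ℕ) + 1 := fun hle =>
      hv ⟨(Fin.is_le v).trans (Nat.le_succ _), hle⟩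
    have hmem : ∀ᶠ ε : ℝ in 𝓝[>] 0, ε ∈ Set.Ioo (0 : ℝ) 1 := Ioo_mem_nhdsGT one_pos
    exact resistance_eq_top_of_eventually_eq_zero (hmem.mono fun ε hε =>
      g.obsProb_eq_zero p (h i) (p.period_pos hε.1 hε.2) hv')

/-- A `3 δ`-interdependent game needs at least three bin widths in `[0, 1]`. -/
theorem Interdependent.three_le [Nontrivial ι] [∀ i, Nonempty (A i)] {g : RandomGame ι A}
    {p : Params} (hg : g.Interdependent (3 * p.δ)) : 3 ≤ p.K := by
  obtain ⟨i, j, hij⟩ := exists_pair_ne ι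
  obtain ⟨k, -, a', -, h⟩ := hg (fun i => Classical.arbitrary (A i)) {i}
    (Set.singleton_nonempty i) fun hu => hij ((hu ▸ Set.mem_univ j : j ∈ ({i} : Set ι)).symm)
  have h₁ : |g.mean a' k - g.mean (fun i => Classical.arbitrary (A i)) k| ≤ 1 := by
    rw [abs_le]
    constructor <;> linarith [g.mean_nonneg a' k, g.mean_le_one a' k,
      g.mean_nonneg (fun i => Classical.arbitrary (A i)) k,
      g.mean_le_one (fun i => Classical.arbitrary (A i)) k]
  have h₂ := p.δ_mul_K
  have h₃ : (3 : ℝ) ≤ p.K := by nlinarith [p.K_cast_pos]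
  exact_mod_cast h₃

end RandomGame

/-! ### One-step behaviour of an agent -/

section Agent

theorem surely_nonneg {S : Type*} [DecidableEq S] (x z : S) : 0 ≤ surely x z := by
  by_cases h : z = x
  · subst h; simp [surely]
  · simp [surely, h]

theorem surely_self {S : Type*} [DecidableEq S] (x : S) : surely x x = 1 := by simp [surely]

theorem coin_nonneg {S : Type*} [DecidableEq S] {q : ℝ} (h₀ : 0 ≤ q) (h₁ : q ≤ 1) (x y z : S) :
    0 ≤ coin q x y z :=
  add_nonneg (mul_nonneg h₀ (surely_nonneg x z))
    (mul_nonneg (sub_nonneg.2 h₁) (surely_nonneg y z))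

theorem coin_left {S : Type*} [DecidableEq S] {q : ℝ} {x y : S} (h : x ≠ y) :
    coin q x y x = q := by
  simp [coin, surely, h]

theorem coin_right {S : Type*} [DecidableEq S] {q : ℝ} {x y : S} (h : x ≠ y) :
    coin q x y y = 1 - q := by
  simp [coin, surely, h.symm]

variable {p : Params} {B : Type*}

/-- The action `a` is the benchmark action of the agent, if it has one. -/
def Follows (s : AgentState p B) (a : B) : Prop := ∀ z ∈ s, z.2.1 = a

/-- The reaction to the observed bin of a discontent agent that rejects, and of any other agent
that plays its benchmark action. -/
def respond : AgentState p B → p.Bin → AgentState p B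
  | none, _ => none
  | some (m, b, w), v =>
      if (w : ℕ) + 2 ≤ v then
        if m = Mood.hopeful then some (Mood.content, b, v) else some (Mood.hopeful, b, w)
      else if (v : ℕ) + 2 ≤ w then
        if m = Mood.watchful then none else some (Mood.watchful, b, w)
      else some (Mood.content, b, w)

theorem Follows.respond {s : AgentState p B} {a : B} (h : Follows s a) (v : p.Bin) :
    Follows (respond s v) a := by
  rcases s with _ | ⟨m, b, w⟩
  · exact h
  · obtain rfl : b = a := h _ rfl
    unfold RITEL.respond
    dsimp only
    split_ifs <;> simp [Follows]

/-- Observing the same bin twice makes the initial mood irrelevant: an agent that already reaches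
its final state in the first period stays there in the second. -/
theorem respond_respond_of_drop {m : Mood} {b : B} {w v : p.Bin} (h : (v : ℕ) + 2 ≤ w) :
    respond (respond (some (m, b, w)) v) v = none := by
  have h' : ¬ (w : ℕ) + 2 ≤ v := by omega
  by_cases hm : m = Mood.watchful <;> simp [respond, h, h', hm]

theorem respond_respond_of_rise {m : Mood} {b : B} {w v : p.Bin} (h : (w : ℕ) + 2 ≤ v) :
    respond (respond (some (m, b, w)) v) v = some (Mood.content, b, v) := by
  by_cases hm : m = Mood.hopeful <;> simp [respond, h, hm]

theorem respond_of_near {m : Mood} {b : B} {w v : p.Bin} (h : ¬ (w : ℕ) + 2 ≤ v)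
    (h' : ¬ (v : ℕ) + 2 ≤ w) : respond (some (m, b, w)) v = some (Mood.content, b, w) := by
  simp [respond, h, h']

/-- The benchmark bin of an agent as a number, `0` if the agent is discontent. -/
def level : AgentState p B → ℕ
  | none => 0
  | some (_, _, w) => w

theorem level_le (s : AgentState p B) : level s ≤ p.K := by
  rcases s with _ | ⟨m, b, w⟩
  · exact Nat.zero_le _
  · exact Fin.is_le w

/-- A benchmark bin can be lowered only by way of discontent; hence the sum of levels serves as an
induction measure. -/
theorem level_le_respond {s : AgentState p B} {v : p.Bin} (h : respond s v ≠ none) :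
    level s ≤ level (respond s v) := by
  rcases s with _ | ⟨m, b, w⟩
  · exact Nat.zero_le _
  · revert h
    unfold respond
    dsimp only
    split_ifs <;> simp [level]
    omega

variable [DecidableEq B] {ε : ℝ}

theorem rpow_F_pos (hε : 0 < ε) (v : p.Bin) : 0 < ε ^ p.F (p.lower v) :=
  Real.rpow_pos_of_pos hε _

theorem rpow_G_le_one (hε : 0 < ε) (hε' : ε < 1) (w v : p.Bin) :
    ε ^ p.G (p.lower w) (p.lower v) ≤ 1 :=
  Real.rpow_le_one hε.le hε'.le (p.G_nonneg _ (p.lower_mem w) _ (p.lower_mem v))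

theorem actionProb_nonneg [Fintype B] (hε : 0 < ε) (hε' : ε < 1) (s : AgentState p B) (a : B) :
    0 ≤ actionProb p ε s a := by
  have hB : (1 : ℝ) ≤ Fintype.card B := by
    have : Nonempty B := ⟨a⟩
    exact_mod_cast Fintype.card_pos
  rcases s with _ | ⟨_ | _ | _, b, w⟩ <;> unfold actionProb
  · positivity
  · dsimp only
    split_ifs
    · exact surely_nonneg _ _
    · linarith
    · exact div_nonneg hε.le (by linarith)
  · exact surely_nonneg _ _
  · exact surely_nonneg _ _

theorem actionProb_pos_of_follows [Fintype B] (hε' : ε < 1) {s : AgentState p B} {a : B} (h : Follows s a) :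
    0 < actionProb p ε s a := by
  rcases s with _ | ⟨m, b, w⟩
  · have : Nonempty B := ⟨a⟩
    have : (0 : ℝ) < Fintype.card B := by exact_mod_cast Fintype.card_pos
    exact one_div_pos.2 this
  · obtain rfl : b = a := h _ rfl
    rcases m with _ | _ | _ <;> simp only [actionProb]
    · split_ifs
      · simp [surely_self]
      · linarith
    · simp [surely_self]
    · simp [surely_self]

theorem actionProb_pos_of_ne [Fintype B] (hε : 0 < ε) {b a : B} {w : p.Bin} (hw : w ≠ p.top) (hab : a ≠ b) :
    0 < actionProb p ε (some (Mood.content, b, w)) a := by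
  have : Nontrivial B := ⟨a, b, hab⟩
  have hB : (1 : ℝ) < Fintype.card B := by exact_mod_cast Fintype.one_lt_card
  simp only [actionProb, if_neg hw, if_neg hab]
  exact div_pos hε (by linarith)

theorem updateProb_nonneg (hε : 0 < ε) (hε' : ε < 1) (s : AgentState p B) (a : B) (v : p.Bin)
    (s' : AgentState p B) : 0 ≤ updateProb p ε s a v s' := by
  rcases s with _ | ⟨_ | _ | _, b, w⟩ <;> unfold updateProb
  · exact coin_nonneg (le_min (rpow_F_pos hε v).le p.cF_pos.le)
      ((min_le_right _ _).trans p.cF_lt_one.le) _ _ _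
  · dsimp only
    split_ifs
    any_goals exact surely_nonneg _ _
    exact coin_nonneg (Real.rpow_nonneg hε.le _) (rpow_G_le_one hε hε' w v) _ _ _
  · dsimp only
    split_ifs <;> exact surely_nonneg _ _
  · dsimp only
    split_ifs <;> exact surely_nonneg _ _

theorem updateProb_some_of_follows {m : Mood} {a : B} {w v : p.Bin} (s : AgentState p B) :
    updateProb p ε (some (m, a, w)) a v s = surely (respond (some (m, a, w)) v) s := by
  rcases m with _ | _ | _ <;> simp only [updateProb, respond] <;> split_ifs <;> simp_all

theorem updateProb_respond_pos {s : AgentState p B} {a : B} (h : Follows s a) (v : p.Bin) :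
    0 < updateProb p ε s a v (respond s v) := by
  rcases s with _ | ⟨m, b, w⟩
  · simp only [updateProb, respond]
    rw [coin_right (by simp)]
    -- Clipping at `cF < 1` keeps rejection possible even where `F` vanishes.
    exact sub_pos.2 ((min_le_right _ _).trans_lt p.cF_lt_one)
  · obtain rfl : b = a := h _ rfl
    rw [updateProb_some_of_follows, surely_self]
    exact one_pos

theorem updateProb_none_accept_pos (hε : 0 < ε) (a : B) (v : p.Bin) :
    0 < updateProb p ε none a v (some (Mood.content, a, v)) := by
  simp only [updateProb]
  rw [coin_left (by simp)]
  exact lt_min (rpow_F_pos hε v) p.cF_pos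

/-- The state of a content agent after a deviation: it adopts every perceived improvement. -/
def adopt (b : B) (w : p.Bin) (a : B) (v : p.Bin) : AgentState p B :=
  if (w : ℕ) + 2 ≤ v then some (Mood.content, a, v) else some (Mood.content, b, w)

theorem updateProb_adopt_pos (hε : 0 < ε) {a b : B} (hab : a ≠ b) (w v : p.Bin) :
    0 < updateProb p ε (some (Mood.content, b, w)) a v (adopt b w a v) := by
  simp only [updateProb, adopt, if_pos hab]
  split_ifs
  · rw [coin_left (by simp [hab])]
    exact Real.rpow_pos_of_pos hε _
  · simp [surely_self]

end Agent

/-! ### Transitions -/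

namespace RandomGame

variable {ι : Type*} [Fintype ι] [DecidableEq ι] {A : ι → Type*} [∀ i, Fintype (A i)]
  [∀ i, DecidableEq (A i)] {g : RandomGame ι A} {p : Params} {ε : ℝ}

theorem transition_nonneg (hε : 0 < ε) (hε' : ε < 1) (x y : State p A) :
    0 ≤ g.transition p ε x y :=
  Finset.sum_nonneg fun a _ => mul_nonneg
    (Finset.prod_nonneg fun i _ => actionProb_nonneg hε hε' (x i) (a i))
    (Finset.sum_nonneg fun v _ => mul_nonneg (g.jointObsProb_nonneg p a _ v)
      (Finset.prod_nonneg fun i _ => updateProb_nonneg hε hε' (x i) (a i) (v i) (y i)))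

theorem transition_pos (hε : 0 < ε) (hε' : ε < 1) {x y : State p A} {a : ∀ i, A i}
    {v : ι → p.Bin} (ha : ∀ i, 0 < actionProb p ε (x i) (a i))
    (hv : 0 < g.jointObsProb p a (p.period ε) v)
    (hy : ∀ i, 0 < updateProb p ε (x i) (a i) (v i) (y i)) : 0 < g.transition p ε x y := by
  have hinner : ∀ (a : ∀ i, A i) (v : ι → p.Bin), 0 ≤ g.jointObsProb p a (p.period ε) v *
      ∏ i, updateProb p ε (x i) (a i) (v i) (y i) := fun a v =>
    mul_nonneg (g.jointObsProb_nonneg p a _ v)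
      (Finset.prod_nonneg fun i _ => updateProb_nonneg hε hε' (x i) (a i) (v i) (y i))
  refine Finset.sum_pos' (fun a _ => mul_nonneg
    (Finset.prod_nonneg fun i _ => actionProb_nonneg hε hε' (x i) (a i))
    (Finset.sum_nonneg fun v _ => hinner a v)) ⟨a, Finset.mem_univ a, mul_pos
      (Finset.prod_pos fun i _ => ha i) ?_⟩
  exact Finset.sum_pos' (fun v _ => hinner a v)
    ⟨v, Finset.mem_univ v, mul_pos hv (Finset.prod_pos fun i _ => hy i)⟩

/-- From an optimal state the chain moves to itself only. -/
theorem transition_of_ae_le (hε : 0 < ε) (hε' : ε < 1) {a : ∀ i, A i} {x : State p A}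
    (hx : ∀ i, x i = some (Mood.content, a i, p.top))
    (h : ∀ i, ∀ᵐ u ∂g.law a, 1 - p.δ ≤ u i) (y : State p A) :
    g.transition p ε x y = if y = x then 1 else 0 := by
  unfold transition
  rw [Finset.sum_eq_single a]
  · have h₁ : ∀ i, actionProb p ε (x i) (a i) = 1 := fun i => by
      simp [hx i, actionProb, surely_self]
    have h₂ : ∀ v, g.jointObsProb p a (p.period ε) v * ∏ i, updateProb p ε (x i) (a i) (v i) (y i)
        = g.jointObsProb p a (p.period ε) v * if y = x then 1 else 0 := fun v => by
      rcases (g.jointObsProb_nonneg p a (p.period ε) v).eq_or_lt with h₀ | h₀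
      · rw [← h₀, zero_mul, zero_mul]
      · have hup : ∀ i, updateProb p ε (x i) (a i) (v i) (y i) = if y i = x i then 1 else 0 := by
          intro i
          have h₃ := g.le_of_jointObsProb_pos p (h i) (p.period_pos hε hε') h₀
          -- Only the two highest bins can be observed, and both are near the top benchmark.
          have h₄ := Fin.is_le (v i)
          rw [hx i, updateProb_some_of_follows, respond_of_near (by simp [Params.top]; omega)
            (by simp only [Params.top, Fin.val_last]; omega), surely, Pi.single_apply]
        simp only [hup]
        congr 1
        rw [Finset.prod_ite_zero]
        simp [funext_iff]
    simp only [h₁, h₂, Finset.prod_const_one, one_mul, ← Finset.sum_mul, g.sum_jointObsProb]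
  · intro b _ hb
    obtain ⟨i, hi⟩ := Function.ne_iff.1 hb
    rw [Finset.prod_eq_zero (Finset.mem_univ i), zero_mul]
    simp [hx i, actionProb, surely, hi]
  · simp

/-- The state after a period in which all agents follow their benchmarks and discontent agents
reject. -/
def react (x : State p A) (v : ι → p.Bin) : State p A := fun i => respond (x i) (v i)

/-- All agents that are not discontent have their benchmark action in the profile `a`. -/
def FollowsAll (x : State p A) (a : ∀ i, A i) : Prop := ∀ i, Follows (x i) (a i)

omit [Fintype ι] [DecidableEq ι] [∀ i, Fintype (A i)] [∀ i, DecidableEq (A i)] in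
theorem FollowsAll.react {x : State p A} {a : ∀ i, A i} (h : FollowsAll x a) (v : ι → p.Bin) :
    FollowsAll (react x v) a := fun i => (h i).respond (v i)

theorem accessible_react (hε : 0 < ε) (hε' : ε < 1) {x : State p A} {a : ∀ i, A i}
    (h : FollowsAll x a) {v : ι → p.Bin} (hv : 0 < g.jointObsProb p a (p.period ε) v) :
    Accessible (g.transition p ε) x (react x v) :=
  Accessible.single (transition_pos hε hε' (fun i => actionProb_pos_of_follows hε' (h i)) hv
    fun i => updateProb_respond_pos (h i) (v i))

theorem accessible_react_react (hε : 0 < ε) (hε' : ε < 1) {x : State p A} {a : ∀ i, A i}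
    (h : FollowsAll x a) {v : ι → p.Bin} (hv : 0 < g.jointObsProb p a (p.period ε) v) :
    Accessible (g.transition p ε) x (react (react x v) v) :=
  (accessible_react hε hε' h hv).trans (transition_nonneg hε hε')
    (accessible_react hε hε' (h.react v) hv)

omit [DecidableEq ι] [∀ i, Fintype (A i)] [∀ i, DecidableEq (A i)] in
/-- If two profiles differ in the mean utility of an agent by three bin widths, then some possible
observations in these profiles differ by three bins. -/
theorem exists_obs_add_three_le (hε : 0 < ε) (hε' : ε < 1) {a a' : ∀ i, A i} {i : ι}
    (h : g.mean a i + 3 * p.δ ≤ g.mean a' i) :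
    ∃ v v', 0 < g.jointObsProb p a (p.period ε) v ∧ 0 < g.jointObsProb p a' (p.period ε) v' ∧
      (v i : ℕ) + 3 ≤ v' i := by
  obtain ⟨v, hv, hvi⟩ := g.exists_obs_le_mean p a (p.period_pos hε hε') i
  obtain ⟨v', hv', hvi'⟩ := g.exists_obs_mean_le p a' (p.period_pos hε hε') i
  have := p.bin_add_three_le (g.mean_nonneg a i) (g.mean_le_one a' i) h
  refine ⟨v, v', hv, hv', ?_⟩
  rw [Fin.le_def] at hvi hvi'
  omega

/-- An agent that can observe bins at distance three while all agents follow their benchmarks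
can become discontent. -/
theorem exists_accessible_none (hε : 0 < ε) (hε' : ε < 1) {x : State p A} {a a' : ∀ i, A i}
    (ha : FollowsAll x a) (ha' : FollowsAll x a') {v v' : ι → p.Bin}
    (hv : 0 < g.jointObsProb p a (p.period ε) v)
    (hv' : 0 < g.jointObsProb p a' (p.period ε) v') {i : ι} (hvv : (v i : ℕ) + 3 ≤ v' i) :
    ∃ y : State p A, Accessible (g.transition p ε) x y ∧ y i = none ∧
      ∀ j, x j = none → y j = none := by
  rcases hxi : x i with _ | ⟨m, b, w⟩
  · exact ⟨x, Accessible.refl _ x, hxi, fun _ h => h⟩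
  by_cases hw : (v i : ℕ) + 2 ≤ w
  · refine ⟨_, accessible_react_react hε hε' ha hv, ?_, fun j hj => ?_⟩
    · simp only [react, hxi]
      exact respond_respond_of_drop hw
    · simp [react, hj, respond]
  -- Here `w ≤ v i + 1`, so `v' i` is a perceived rise. Once `v' i` is the benchmark, returning to
  -- `a` makes `v i` a perceived drop.
  · have hw' : (w : ℕ) + 2 ≤ v' i := by omega
    refine ⟨_, (accessible_react_react hε hε' ha' hv').trans (transition_nonneg hε hε')
      (accessible_react_react hε hε' ((ha.react v').react v') hv), ?_, fun j hj => ?_⟩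
    · simp only [react, hxi]
      rw [respond_respond_of_rise hw']
      exact respond_respond_of_drop (by omega)
    · simp [react, hj, respond]

/-- Discontent spreads: if some agent is discontent, the all-discontent state is accessible. -/
theorem accessible_allDiscontent_of_none [∀ i, Nonempty (A i)]
    (hg : g.Interdependent (3 * p.δ)) (hε : 0 < ε) (hε' : ε < 1) {x : State p A} {i₀ : ι}
    (hx : x i₀ = none) : Accessible (g.transition p ε) x (allDiscontent p A) := by
  classical
  induction hn : (Finset.univ.filter fun i => x i ≠ none).card using Nat.strong_induction_on
    generalizing x with
  | _ n ih =>
  by_cases hall : ∀ i, x i = none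
  · rw [show x = allDiscontent p A from funext hall]
    exact Accessible.refl _ _
  push Not at hall
  obtain ⟨i₁, hi₁⟩ := hall
  have hex : ∀ i, ∃ a, Follows (x i) a := fun i => by
    rcases x i with _ | ⟨m, b, w⟩
    · exact ⟨Classical.arbitrary _, by simp [Follows]⟩
    · exact ⟨b, by simp [Follows]⟩
  choose a ha using hex
  -- Only discontent agents change their actions, and they have no benchmark; so both profiles can
  -- be played without any experiment.
  obtain ⟨i, hi, a', ha', hmean⟩ := hg a {j | x j = none} ⟨i₀, hx⟩
    fun h => hi₁ (h ▸ Set.mem_univ i₁ : i₁ ∈ {j | x j = none})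
  have hfol : FollowsAll x a' := fun j => by
    by_cases hj : x j = none
    · simp [hj, Follows]
    · rw [ha' j hj]
      exact ha j
  have key : ∃ y : State p A, Accessible (g.transition p ε) x y ∧ y i = none ∧
      ∀ j, x j = none → y j = none := by
    rcases le_abs.1 hmean with h | h
    · obtain ⟨v, v', hv, hv', hvv⟩ := exists_obs_add_three_le (p := p) hε hε'
        (show g.mean a i + 3 * p.δ ≤ g.mean a' i by linarith)
      exact exists_accessible_none hε hε' ha hfol hv hv' hvv
    · obtain ⟨v, v', hv, hv', hvv⟩ := exists_obs_add_three_le (p := p) hε hε'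
        (show g.mean a' i + 3 * p.δ ≤ g.mean a i by linarith)
      exact exists_accessible_none hε hε' hfol ha hv hv' hvv
  obtain ⟨y, hxy, hyi, hy⟩ := key
  refine hxy.trans (transition_nonneg hε hε') (ih _ ?_ (hy i₀ hx) rfl)
  rw [← hn]
  refine Finset.card_lt_card ⟨fun j hj => ?_, fun hsub => ?_⟩
  · simp only [Finset.mem_filter, Finset.mem_univ, true_and] at hj ⊢
    exact fun h => hj (hy j h)
  · have := hsub (Finset.mem_filter.2 ⟨Finset.mem_univ i, hi⟩)
    exact (Finset.mem_filter.1 this).2 hyi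

/-- The state after a period in which the content agent `i` deviates to `a`. -/
def deviate (x : State p A) (i : ι) (b : A i) (w : p.Bin) (a : A i) (v : ι → p.Bin) : State p A :=
  Function.update (react x v) i (adopt b w a (v i))

theorem accessible_deviate (hε : 0 < ε) (hε' : ε < 1) {x : State p A} {i : ι} {b : A i}
    {w : p.Bin} (hx : x i = some (Mood.content, b, w)) (hw : w ≠ p.top) {a : ∀ i, A i}
    (hab : a i ≠ b) (h : ∀ j ≠ i, Follows (x j) (a j)) {v : ι → p.Bin}
    (hv : 0 < g.jointObsProb p a (p.period ε) v) :
    Accessible (g.transition p ε) x (deviate x i b w (a i) v) := by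
  refine Accessible.single (transition_pos hε hε' (a := a) (v := v) (fun j => ?_) hv fun j => ?_)
  · rcases eq_or_ne j i with rfl | hj
    · rw [hx]
      exact actionProb_pos_of_ne hε hw hab
    · exact actionProb_pos_of_follows hε' (h j hj)
  · rcases eq_or_ne j i with rfl | hj
    · rw [hx, deviate, Function.update_self]
      exact updateProb_adopt_pos hε hab w (v j)
    · rw [deviate, Function.update_of_ne hj]
      exact updateProb_respond_pos (h j hj) (v j)

/-- Every state leads to the all-discontent state or to an optimal state. -/
theorem accessible_allDiscontent_or_optimal [Nontrivial ι] [∀ i, Nonempty (A i)]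
    (hg : g.Interdependent (3 * p.δ)) (hε : 0 < ε) (hε' : ε < 1) (x : State p A) :
    Accessible (g.transition p ε) x (allDiscontent p A) ∨
      ∃ y ∈ g.optimalStates p, Accessible (g.transition p ε) x y := by
  have hK : 2 ≤ p.K := le_trans (by norm_num) hg.three_le
  have hP := transition_nonneg (g := g) (p := p) hε hε'
  have ht := p.period_pos hε hε'
  -- The measure is the distance of the total benchmark level from its maximum.
  induction hn : Fintype.card ι * p.K - ∑ i, level (x i) using Nat.strong_induction_on
    generalizing x with
  | _ n ih =>
  have hbound : ∀ y : State p A, ∑ i, level (y i) ≤ Fintype.card ι * p.K := fun y => by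
    simpa using Finset.sum_le_card_nsmul Finset.univ (fun i => level (y i)) p.K
      fun i _ => level_le (y i)
  -- It suffices to reach a discontent agent, or a state with higher benchmark bins.
  have hnone : ∀ (y : State p A) (i : ι), Accessible (g.transition p ε) x y → y i = none →
      Accessible (g.transition p ε) x (allDiscontent p A) := fun y i hxy hy =>
    hxy.trans hP (accessible_allDiscontent_of_none hg hε hε' hy)
  have hrise : ∀ y : State p A, Accessible (g.transition p ε) x y →
      (∀ j, level (x j) ≤ level (y j)) → (∃ j, level (x j) < level (y j)) →
      Accessible (g.transition p ε) x (allDiscontent p A) ∨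
        ∃ y ∈ g.optimalStates p, Accessible (g.transition p ε) x y := fun y hxy hle hlt => by
    have hsum : ∑ i, level (x i) < ∑ i, level (y i) :=
      Finset.sum_lt_sum (fun j _ => hle j) (hlt.imp fun j hj => ⟨Finset.mem_univ j, hj⟩)
    have := hbound y
    refine (ih _ (by omega) y rfl).imp (fun h => hxy.trans hP h) ?_
    rintro ⟨z, hz, hyz⟩
    exact ⟨z, hz, hxy.trans hP hyz⟩
  by_cases hd : ∃ i, x i = none
  · obtain ⟨i, hi⟩ := hd
    exact Or.inl (hnone x i (Accessible.refl _ x) hi)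
  push Not at hd
  have hx : ∀ i, ∃ (m : Mood) (b : A i) (w : p.Bin), x i = some (m, b, w) := fun i => by
    obtain ⟨⟨m, b, w⟩, h⟩ := Option.ne_none_iff_exists'.1 (hd i)
    exact ⟨m, b, w, h⟩
  choose m b w hx using hx
  have hb : FollowsAll x b := fun i => by simp [Follows, hx i]
  by_cases hdrop : ∃ v, 0 < g.jointObsProb p b (p.period ε) v ∧ ∃ i, (v i : ℕ) + 2 ≤ w i
  · obtain ⟨v, hv, i, hvi⟩ := hdrop
    refine Or.inl (hnone _ i (accessible_react_react hε hε' hb hv) ?_)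
    simp only [react, hx i]
    exact respond_respond_of_drop hvi
  push Not at hdrop
  by_cases hup : ∃ v, 0 < g.jointObsProb p b (p.period ε) v ∧ ∃ i, (w i : ℕ) + 2 ≤ v i
  · obtain ⟨v, hv, i, hvi⟩ := hup
    have hacc := accessible_react_react hε hε' hb hv
    by_cases hd' : ∃ j, react (react x v) v j = none
    · obtain ⟨j, hj⟩ := hd'
      exact Or.inl (hnone _ j hacc hj)
    push Not at hd'
    refine hrise _ hacc (fun j => ?_) ⟨i, ?_⟩
    -- Discontent in the middle would persist, because `respond` never leaves it.
    · have h₁ : react x v j ≠ none := fun h => hd' j (congrArg (respond · (v j)) h)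
      exact (level_le_respond h₁).trans (level_le_respond (hd' j))
    · simp only [react, hx i]
      rw [respond_respond_of_rise hvi]
      simp only [level]
      omega
  push Not at hup
  -- Now every possible observation is near the benchmarks, so a single period makes all agents
  -- content without changing any benchmark.
  obtain ⟨v₀, hv₀⟩ := g.exists_obs p b (p.period ε)
  set y := react x v₀ with hy_def
  have hxy : Accessible (g.transition p ε) x y := accessible_react hε hε' hb hv₀
  have hy : ∀ i, y i = some (Mood.content, b i, w i) := fun i => by
    simp only [hy_def, react, hx i]
    have h₁ := hdrop v₀ hv₀ i
    have h₂ := hup v₀ hv₀ i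
    exact respond_of_near (by omega) (by omega)
  have hxy_level : ∀ i, level (x i) = level (y i) := fun i => by rw [hx i, hy i]; rfl
  by_cases htop : ∀ i, w i = p.top
  · refine Or.inr ⟨y, (g.mem_optimalStates_iff p hK).2 ⟨b, fun i => ?_, fun i => ?_⟩, hxy⟩
    · rw [hy i, htop i]
    · refine g.ae_le_of_forall_obs p hK ht fun v hv => ?_
      have := hdrop v hv i
      rw [htop i, Params.top, Fin.val_last] at this
      omega
  push Not at htop
  -- An agent below the top bin may experiment; interdependence with `J = {i}` supplies an
  -- experiment that another agent `j` notices.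
  obtain ⟨i, hi⟩ := htop
  obtain ⟨k, hk⟩ := exists_ne i
  obtain ⟨j, hji, a', ha', hmean⟩ := hg b {i} (Set.singleton_nonempty i)
    fun h => hk (h ▸ Set.mem_univ k : k ∈ ({i} : Set ι))
  simp only [Set.mem_singleton_iff] at hji ha'
  have ha'i : a' i ≠ b i := fun h => by
    have : a' = b := funext fun l => by
      rcases eq_or_ne l i with rfl | hl
      · exact h
      · exact ha' l hl
    rw [this, sub_self, abs_zero] at hmean
    linarith [p.δ_pos]
  have hfol : ∀ z : State p A, FollowsAll z b → ∀ l ≠ i, Follows (z l) (a' l) := fun z hz l hl =>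
    ha' l hl ▸ hz l
  have hyb : FollowsAll y b := hb.react v₀
  -- A possible observation of `j` after the deviation of `i`, at distance three from `v₁`.
  obtain ⟨v₁, v₂, hv₁, hv₂, hfar⟩ : ∃ v₁ v₂, 0 < g.jointObsProb p b (p.period ε) v₁ ∧
      0 < g.jointObsProb p a' (p.period ε) v₂ ∧
      ((v₁ j : ℕ) + 3 ≤ v₂ j ∨ (v₂ j : ℕ) + 3 ≤ v₁ j) := by
    rcases le_abs.1 hmean with h | h
    · obtain ⟨v, v', hv, hv', hvv⟩ := exists_obs_add_three_le (p := p) hε hε'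
        (show g.mean b j + 3 * p.δ ≤ g.mean a' j by linarith)
      exact ⟨v, v', hv, hv', Or.inl hvv⟩
    · obtain ⟨v, v', hv, hv', hvv⟩ := exists_obs_add_three_le (p := p) hε hε'
        (show g.mean a' j + 3 * p.δ ≤ g.mean b j by linarith)
      exact ⟨v', v, hv', hv, Or.inr hvv⟩
  have hz := accessible_deviate hε hε' (hy i) hi ha'i (hfol y hyb) hv₂
  by_cases hadopt : (w i : ℕ) + 2 ≤ v₂ i
  · by_cases hzn : ∃ l, deviate y i (b i) (w i) (a' i) v₂ l = none
    · obtain ⟨l, hl⟩ := hzn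
      exact Or.inl (hnone _ l (hxy.trans hP hz) hl)
    push Not at hzn
    have hi_lt : level (y i) < level (deviate y i (b i) (w i) (a' i) v₂ i) := by
      rw [deviate, Function.update_self, adopt, if_pos hadopt, hy i]
      simp only [level]
      omega
    refine hrise _ (hxy.trans hP hz) (fun l => ?_) ⟨i, hxy_level i ▸ hi_lt⟩
    rw [hxy_level l]
    rcases eq_or_ne l i with rfl | hl
    · exact hi_lt.le
    · have := hzn l
      rw [deviate, Function.update_of_ne hl] at this ⊢
      exact level_le_respond this
  -- If `i` does not adopt the deviation, it remains content with its old benchmark and can repeat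
  -- it, so that `j` observes `v₂ j` twice.
  · have hdev : ∀ z : State p A, deviate z i (b i) (w i) (a' i) v₂ i
        = some (Mood.content, b i, w i) := fun z => by
      rw [deviate, Function.update_self, adopt, if_neg hadopt]
    have hdev_ne : ∀ z : State p A, ∀ l ≠ i, deviate z i (b i) (w i) (a' i) v₂ l
        = respond (z l) (v₂ l) := fun z l hl => by
      rw [deviate, Function.update_of_ne hl]
      rfl
    have hfol' : ∀ z : State p A, FollowsAll z b →
        FollowsAll (deviate z i (b i) (w i) (a' i) v₂) b := fun z hzb l => by
      rcases eq_or_ne l i with rfl | hl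
      · rw [hdev]
        simp [Follows]
      · rw [hdev_ne z l hl]
        exact (hzb l).respond _
    have hz' := (hxy.trans hP hz).trans hP
      (accessible_deviate hε hε' (hdev y) hi ha'i (hfol _ (hfol' y hyb)) hv₂)
    set z := deviate (deviate y i (b i) (w i) (a' i) v₂) i (b i) (w i) (a' i) v₂ with hz_def
    have hzj : z j = respond (respond (some (Mood.content, b j, w j)) (v₂ j)) (v₂ j) := by
      rw [hz_def, hdev_ne _ j hji, hdev_ne _ j hji, hy j]
    have h₁ := hdrop v₁ hv₁ j
    have h₂ := hup v₁ hv₁ j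
    -- By `h₁` and `h₂`, `v₁ j` is within one bin of `w j`, so `v₂ j` is at least two bins away. If
    -- `j` rises to `v₂ j`, the return of `i` to `b i` then brings `j` down through `v₁ j`.
    rcases hfar with hfar | hfar
    · rw [respond_respond_of_rise (by omega)] at hzj
      have hzb : FollowsAll z b := hfol' _ (hfol' y hyb)
      refine Or.inl (hnone _ j (hz'.trans hP (accessible_react_react hε hε' hzb hv₁)) ?_)
      simp only [react, hzj]
      exact respond_respond_of_drop (by omega)
    · rw [respond_respond_of_drop (by omega)] at hzj
      exact Or.inl (hnone z j hz' hzj)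

theorem transition_allDiscontent_pos [∀ i, Nonempty (A i)] (hε : 0 < ε) (hε' : ε < 1) :
    0 < g.transition p ε (allDiscontent p A) (allDiscontent p A) := by
  let a : ∀ i, A i := fun i => Classical.arbitrary (A i)
  have ha : FollowsAll (allDiscontent p A) a := fun i => by simp [Follows, allDiscontent]
  obtain ⟨v, hv⟩ := g.exists_obs p a (p.period ε)
  exact transition_pos hε hε' (fun i => actionProb_pos_of_follows hε' (ha i)) hv
    fun i => updateProb_respond_pos (ha i) (v i)

/-- One period from `D` suffices: the agents happen to play `a`, get utility 1 in all rounds, and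
all accept. -/
theorem mem_possibleStates_of_law_pos (hε : 0 < ε) (hε' : ε < 1) {a : ∀ i, A i}
    (ha : 0 < g.law a {u | ∀ i, u i = 1}) :
    (fun i => some (Mood.content, a i, p.top)) ∈ g.possibleStates p ε := by
  obtain ⟨s, hs, hv⟩ := g.exists_obs_of_law_pos p a (p.period ε) ha
  have ht := p.period_pos hε hε'
  have havg : ∀ i, p.bin (average s i) = p.top := fun i => by
    rw [le_antisymm (average_le ht fun k => (hs k i).le) (le_average ht fun k => (hs k i).ge),
      p.bin_one]
  simp only [havg] at hv
  exact Accessible.single (transition_pos hε hε' (a := a)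
    (fun i => actionProb_pos_of_follows hε' (by simp [Follows, allDiscontent])) hv
    fun i => updateProb_none_accept_pos hε (a i) p.top)

theorem eq_of_accessible_optimal (hK : 2 ≤ p.K) (hε : 0 < ε) (hε' : ε < 1) {x y : State p A}
    (hx : x ∈ g.optimalStates p) (h : Accessible (g.transition p ε) x y) : y = x := by
  obtain ⟨a, hxa, ha⟩ := (g.mem_optimalStates_iff p hK).1 hx
  refine h.eq_of_forall (transition_nonneg hε hε') fun z hz => ?_
  rw [transition_of_ae_le hε hε' hxa ha] at hz
  by_contra hne
  simp [hne] at hz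

end RandomGame

end RITEL

/-! ### Classification of the recurrence classes -/

open RITEL in
theorem mainTheorem11 {ι : Type*} [Fintype ι] [DecidableEq ι] [Nontrivial ι]
    {A : ι → Type*} [∀ i, Fintype (A i)] [∀ i, DecidableEq (A i)] [∀ i, Nonempty (A i)]
    (g : RandomGame ι A) (p : Params) (hg : g.Interdependent (3 * p.δ))
    (ε : ℝ) (hε : 0 < ε) (hε' : ε < 1) :
    (∀ x ∈ g.optimalStates p, IsAbsorbing (g.transition p ε) x) ∧
    ((g.optimalStates p ∩ g.possibleStates p ε).Nonempty →
      ∀ C : Set (State p A), IsRecurrenceClass (g.transition p ε) C ↔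
        ∃ x ∈ g.optimalStates p, C = {x}) ∧
    (∀ a : ∀ i, A i, 0 < g.law a {u | ∀ i, u i = 1} →
      (fun i => some (Mood.content, a i, p.top)) ∈ g.possibleStates p ε) ∧
    (g.optimalStates p ∩ g.possibleStates p ε = ∅ →
      Matrix.IsIrreducible
        (fun x y : g.possibleStates p ε => g.transition p ε x y) ∧
      (∀ x ∈ g.possibleStates p ε, IsAperiodicAt (g.transition p ε) x) ∧
      ∀ C : Set (State p A), IsRecurrenceClass (g.transition p ε) C ↔
        C = g.possibleStates p ε ∨ ∃ x ∈ g.optimalStates p, C = {x}) := by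
  have hK : 2 ≤ p.K := le_trans (by norm_num) hg.three_le
  have hP := RandomGame.transition_nonneg (g := g) (p := p) hε hε'
  have hsingle : ∀ x ∈ g.optimalStates p, IsRecurrenceClass (g.transition p ε) {x} :=
    fun x hx => isRecurrenceClass_singleton fun y hy =>
      RandomGame.eq_of_accessible_optimal hK hε hε' hx hy
  have hloop := RandomGame.transition_allDiscontent_pos (g := g) (p := p) hε hε'
  have hreach := RandomGame.accessible_allDiscontent_or_optimal hg hε hε'
  refine ⟨fun x hx => ?_, ?_, fun a ha => RandomGame.mem_possibleStates_of_law_pos hε hε' ha,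
    fun hempty => ?_⟩
  · obtain ⟨a, hxa, ha⟩ := (g.mem_optimalStates_iff p hK).1 hx
    rw [IsAbsorbing, RandomGame.transition_of_ae_le hε hε' hxa ha, if_pos rfl]
  · rintro ⟨z, hz, hDz⟩ C
    constructor
    · intro hC
      obtain ⟨x, hx⟩ := hC.1
      -- A state that leads to `D` also leads to the optimal state `z`, so every class contains an
      -- optimal state.
      obtain ⟨y, hy, hxy⟩ : ∃ y ∈ g.optimalStates p, Accessible (g.transition p ε) x y :=
        (hreach x).elim (fun h => ⟨z, hz, h.trans hP hDz⟩) id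
      exact ⟨y, hy, hC.eq_of_mem (hsingle y hy) (hC.2.2 x hx y hxy) rfl⟩
    · rintro ⟨x, hx, rfl⟩
      exact hsingle x hx
  -- An optimal state reached from a possible state would itself be possible; hence every possible
  -- state leads back to `D`.
  · have hback : ∀ x, Accessible (g.transition p ε) (allDiscontent p A) x →
        Accessible (g.transition p ε) x (allDiscontent p A) := fun x hx =>
      (hreach x).resolve_right fun ⟨y, hy, hxy⟩ =>
        (Set.eq_empty_iff_forall_notMem.1 hempty) y ⟨hy, hx.trans hP hxy⟩
    have hclass : IsRecurrenceClass (g.transition p ε) (g.possibleStates p ε) :=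
      isRecurrenceClass_accessible hP hback
    refine ⟨isIrreducible_accessible hP hloop hback, fun x hx =>
      isAperiodicAt_of_accessible_loop hP hloop (hback x hx) hx, fun C => ⟨fun hC => ?_, ?_⟩⟩
    · obtain ⟨x, hx⟩ := hC.1
      rcases hreach x with h | ⟨y, hy, hxy⟩
      · exact Or.inl (hC.eq_of_mem hclass (hC.2.2 x hx _ h) (Accessible.refl _ _))
      · exact Or.inr ⟨y, hy, hC.eq_of_mem (hsingle y hy) (hC.2.2 x hx y hxy) rfl⟩
    · rintro (rfl | ⟨x, hx, rfl⟩)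
      · exact hclass
      · exact hsingle x hx
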